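/- Let $N\in\mathbb N$, let $\Omega\subset\mathbb R^N$ be a non-empty open set, and for $p\in(1,\infty)$ let $W^{1,p}(\Omega)$ be the Sobolev space of all real-valued $u\in L^p(\Omega)$ whose distributional first partial derivatives lie in $L^p(\Omega)$, with $$\|u\|^p_{W^{1,p}(\Omega)}=\|u\|^p_{L^p(\Omega)}+\sum_{i=1}^N\|\partial_i u\|^p_{L^p(\Omega)}.$$ Let $\tilde W^{1,p}(\Omega)$ be the closure in $W^{1,p}(\Omega)$ of the set of those functions in $W^{1,p}(\Omega)$ that are restrictions to $\Omega$ of continuous functions with compact support on $\overline\Omega$. For $A\subset\overline\Omega$ define the relative $p$-capacity $$\operatorname{Cap}_{p,\Omega}(A)=\inf\bigl\{\|u\|^p_{W^{1,p}(\Omega)} : u\in\tilde W^{1,p}(\Omega),\ \exists\, O \text{ open in }\overline\Omega \text{ with } A\subset O \text{ and } u\ge 1 \text{ a.e. on } O\cap\Omega\bigr\}\in[0,\infty],$$ with $\inf\emptyset=\infty$. Let $1<q\le p<\infty$ and let $A\subset\overline\Omega$ satisfy $\operatorname{Cap}_{p,\Omega}(A)=0$. Then $\operatorname{Cap}_{q,\Omega}(A)=0$.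 -/

import Mathlib

open MeasureTheory Set
open scoped ENNReal ContDiff

noncomputable section

namespace RelativeCapacity

variable {N : ℕ}

/-- `g` is the weak (distributional) partial derivative `∂u/∂xᵢ` of `u` on the open set `Ω`, where
both functions are locally integrable on `Ω`: one has `∫_Ω u ∂ᵢφ = -∫_Ω g φ` for all test
functions `φ ∈ 𝒟(Ω)`. -/
def HasWeakPartial (Ω : Set (EuclideanSpace ℝ (Fin N))) (i : Fin N)
    (u g : EuclideanSpace ℝ (Fin N) → ℝ) : Prop :=
  LocallyIntegrableOn u Ω ∧ LocallyIntegrableOn g Ω ∧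
    ∀ φ : EuclideanSpace ℝ (Fin N) → ℝ,
      ContDiff ℝ ∞ φ → HasCompactSupport φ → tsupport φ ⊆ Ω →
        ∫ x in Ω, u x * fderiv ℝ φ x (EuclideanSpace.single i 1) = -∫ x in Ω, g x * φ x

open Classical in
/-- The weak partial derivative of `u` in direction `i` on `Ω` (a chosen representative; it is
unique almost everywhere on `Ω`), and `0` if there is none. -/
def weakPartial (Ω : Set (EuclideanSpace ℝ (Fin N))) (i : Fin N)
    (u : EuclideanSpace ℝ (Fin N) → ℝ) : EuclideanSpace ℝ (Fin N) → ℝ :=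
  if h : ∃ g, HasWeakPartial Ω i u g then h.choose else 0

/-- `u` represents an element of the Sobolev space `W^{1,p}(Ω)`. Only the values of `u` on `Ω`
matter. -/
def MemW (Ω : Set (EuclideanSpace ℝ (Fin N))) (p : ℝ)
    (u : EuclideanSpace ℝ (Fin N) → ℝ) : Prop :=
  MemLp u (ENNReal.ofReal p) (volume.restrict Ω) ∧
    ∀ i : Fin N, ∃ g : EuclideanSpace ℝ (Fin N) → ℝ,
      HasWeakPartial Ω i u g ∧ MemLp g (ENNReal.ofReal p) (volume.restrict Ω)

/-- The `p`-th power of the Sobolev norm,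
`‖u‖^p_{W^{1,p}(Ω)} = ‖u‖^p_{L^p(Ω)} + ∑ᵢ ‖∂ᵢu‖^p_{L^p(Ω)}`. -/
def sobolevNormPow (Ω : Set (EuclideanSpace ℝ (Fin N))) (p : ℝ)
    (u : EuclideanSpace ℝ (Fin N) → ℝ) : ℝ≥0∞ :=
  eLpNorm u (ENNReal.ofReal p) (volume.restrict Ω) ^ p +
    ∑ i : Fin N, eLpNorm (weakPartial Ω i u) (ENNReal.ofReal p) (volume.restrict Ω) ^ p

/-- `v` restricts to an element of `C_c(Ω̄)`: its restriction to `Ω̄` is continuous and has compact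
support in the space `Ω̄`. -/
def MemCc (Ω : Set (EuclideanSpace ℝ (Fin N))) (v : EuclideanSpace ℝ (Fin N) → ℝ) : Prop :=
  Continuous ((closure Ω).domRestrict v) ∧ HasCompactSupport ((closure Ω).domRestrict v)

/-- `u` represents an element of `W̃^{1,p}(Ω)`, the closure of `W^{1,p}(Ω) ∩ C_c(Ω̄)` in
`W^{1,p}(Ω)`. -/
def MemWTilde (Ω : Set (EuclideanSpace ℝ (Fin N))) (p : ℝ)
    (u : EuclideanSpace ℝ (Fin N) → ℝ) : Prop :=
  MemW Ω p u ∧ ∀ ε : ℝ≥0∞, 0 < ε →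
    ∃ v : EuclideanSpace ℝ (Fin N) → ℝ,
      MemW Ω p v ∧ MemCc Ω v ∧ sobolevNormPow Ω p (u - v) < ε

/-- `O` is an open subset of the topological space `Ω̄`. -/
def IsRelOpen (Ω O : Set (EuclideanSpace ℝ (Fin N))) : Prop :=
  ∃ U : Set (EuclideanSpace ℝ (Fin N)), IsOpen U ∧ O = U ∩ closure Ω

/-- The admissible class `𝒴_{p,Ω}(A)`: all `u ∈ W̃^{1,p}(Ω)` for which there is a set `O`, open in
`Ω̄`, with `A ⊆ O` and `u ≥ 1` almost everywhere on `O ∩ Ω`. -/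
def admissible (Ω : Set (EuclideanSpace ℝ (Fin N))) (p : ℝ)
    (A : Set (EuclideanSpace ℝ (Fin N))) : Set (EuclideanSpace ℝ (Fin N) → ℝ) :=
  {u | MemWTilde Ω p u ∧ ∃ O : Set (EuclideanSpace ℝ (Fin N)),
    IsRelOpen Ω O ∧ A ⊆ O ∧ ∀ᵐ x ∂(volume.restrict (O ∩ Ω)), 1 ≤ u x}

/-- The relative `p`-capacity `Cap_{p,Ω}(A) ∈ [0,∞]`, equal to `∞` if no function is admissible. -/
def relCap (Ω : Set (EuclideanSpace ℝ (Fin N))) (p : ℝ)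
    (A : Set (EuclideanSpace ℝ (Fin N))) : ℝ≥0∞ :=
  ⨅ u ∈ admissible Ω p A, sobolevNormPow Ω p u

end RelativeCapacity

end

/-!
Hölder's inequality embeds `W^{1,p}(Ω)` into `W^{1,q}(Ω)` only locally, so one glues. Take a smooth
partition of unity `ρ₀, ρ₁, …` with compact supports; multiplication by `ρₙ` is bounded from
`W^{1,p}(Ω)` to `W^{1,q}(Ω)`, with some constant `Cₙ`, and maps `W̃^{1,p}(Ω)` into `W̃^{1,q}(Ω)`.
Choose `uₙ` admissible for `p` with norm below `δₙ / Cₙ`, where `∑ δₙ < ε`. Then `u = ∑ ρₙ uₙ`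
converges absolutely in `W^{1,q}(Ω)`, so `u ∈ W̃^{1,q}(Ω)` has norm below `ε`. Finally `uₙ ≥ 1` on a
neighbourhood `Oₙ` of `A`; requiring `x ∈ Oₙ` only where `x ∈ supp ρₙ` leaves, by local finiteness,
a neighbourhood of `A`, and there `u` is a convex combination of values `≥ 1`.
-/

namespace RelativeCapacity

open Filter Topology
open scoped Manifold

lemma exists_pos_forall_lt_mul_rpow_lt {C ε : ℝ≥0∞} {r : ℝ} (hC : C ≠ ⊤) (hr : 0 < r)
    (hε : 0 < ε) : ∃ δ : ℝ≥0∞, 0 < δ ∧ ∀ t < δ, C * t ^ r < ε := by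
  have hlim : Tendsto (fun t : ℝ≥0∞ => C * t ^ r) (𝓝 0) (𝓝 0) := by
    simpa [hr] using ENNReal.Tendsto.const_mul
      ((ENNReal.continuous_rpow_const (y := r)).tendsto 0) (.inr hC)
  exact ENNReal.nhds_zero_basis.eventually_iff.1 (hlim.eventually_lt_const hε)

lemma isOpen_setOf_forall_mem_imp_mem {X ι : Type*} [TopologicalSpace X] {F U : ι → Set X}
    (hlf : LocallyFinite F) (hF : ∀ n, IsClosed (F n)) (hU : ∀ n, IsOpen (U n)) :
    IsOpen {x | ∀ n, x ∈ F n → x ∈ U n} := by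
  have hcompl : {x | ∀ n, x ∈ F n → x ∈ U n} = (⋃ n, F n \ U n)ᶜ := by
    ext x
    simp
  rw [hcompl, isOpen_compl_iff]
  exact (hlf.subset fun n => sdiff_subset).isClosed_iUnion fun n => (hF n).sdiff (hU n)

lemma exists_smoothPartitionOfUnity_hasCompactSupport (E : Type*) [NormedAddCommGroup E]
    [NormedSpace ℝ E] [FiniteDimensional ℝ E] :
    ∃ ρ : SmoothPartitionOfUnity ℕ 𝓘(ℝ, E) E, ∀ n, HasCompactSupport (ρ n) := by
  have hcover : (univ : Set E) ⊆ ⋃ n : ℕ, Metric.ball 0 n := by rw [Metric.iUnion_ball_nat]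
  obtain ⟨ρ, hρ⟩ := SmoothPartitionOfUnity.exists_isSubordinate 𝓘(ℝ, E) isClosed_univ
    (fun n : ℕ => Metric.ball (0 : E) n) (fun n => Metric.isOpen_ball) hcover
  exact ⟨ρ, fun n => (isCompact_closedBall 0 n).of_isClosed_subset (isClosed_tsupport _)
    ((hρ n).trans Metric.ball_subset_closedBall)⟩

section Lp

variable {X E ι : Type*} [MeasurableSpace X] {μ : Measure X} [NormedAddCommGroup E]

lemma eLpNorm_le_tsum_of_hasSum [Countable ι] {p : ℝ≥0∞} (hp : 1 ≤ p) {f : ι → X → E} {g : X → E}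
    (hf : ∀ n, AEStronglyMeasurable (f n) μ) (hg : ∀ᵐ x ∂μ, HasSum (fun n => f n x) (g x)) :
    eLpNorm g p μ ≤ ∑' n, eLpNorm (f n) p μ := by
  refine Lp.eLpNorm_le_of_ae_tendsto (u := atTop) (.of_forall fun s => ?_)
    (fun s : Finset ι => Finset.aestronglyMeasurable_fun_sum s fun n _ => hf n) hg
  calc eLpNorm (fun x => ∑ n ∈ s, f n x) p μ
    _ ≤ ∑ n ∈ s, eLpNorm (f n) p μ := by
      simpa only [Finset.sum_fn] using eLpNorm_sum_le (fun n _ => hf n) hp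
    _ ≤ ∑' n, eLpNorm (f n) p μ := ENNReal.sum_le_tsum s

lemma memLp_of_hasSum [Countable ι] {p : ℝ≥0∞} (hp : 1 ≤ p) {f : ι → X → E} {g : X → E}
    (hf : ∀ n, AEStronglyMeasurable (f n) μ) (hsum : ∑' n, eLpNorm (f n) p μ ≠ ⊤)
    (hg : ∀ᵐ x ∂μ, HasSum (fun n => f n x) (g x)) : MemLp g p μ :=
  ⟨aestronglyMeasurable_of_tendsto_ae atTop
      (fun s : Finset ι => Finset.aestronglyMeasurable_fun_sum s fun n _ => hf n) hg,
    (eLpNorm_le_tsum_of_hasSum hp hf hg).trans_lt hsum.lt_top⟩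

lemma exists_eLpNorm_mul_le [TopologicalSpace X] [OpensMeasurableSpace X]
    [IsFiniteMeasureOnCompacts μ] {p q : ℝ≥0∞} (hqp : q ≤ p) {ψ : X → ℝ} (hψ : Continuous ψ)
    (hc : HasCompactSupport ψ) :
    ∃ C ≠ ⊤, ∀ f : X → ℝ, AEStronglyMeasurable f μ → eLpNorm (ψ * f) q μ ≤ C * eLpNorm f p μ := by
  have : ENNReal.HolderTriple (q⁻¹ - p⁻¹)⁻¹ p q :=
    ⟨by rw [inv_inv, tsub_add_cancel_of_le (ENNReal.inv_le_inv.2 hqp)]⟩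
  have hψLp : MemLp ψ (q⁻¹ - p⁻¹)⁻¹ μ := hψ.memLp_of_hasCompactSupport hc
  exact ⟨_, hψLp.eLpNorm_ne_top, fun f hf => by
    simpa only [smul_eq_mul] using
      eLpNorm_smul_le_mul_eLpNorm (r := q) hf hψLp.aestronglyMeasurable⟩

lemma integral_mul_eq_tsum_of_hasSum [TopologicalSpace X] [OpensMeasurableSpace X]
    [IsFiniteMeasureOnCompacts μ] [Countable ι] {p : ℝ≥0∞} (hp : 1 ≤ p)
    {f : ι → X → ℝ} {g ψ : X → ℝ} (hf : ∀ n, AEStronglyMeasurable (f n) μ)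
    (hsum : ∑' n, eLpNorm (f n) p μ ≠ ⊤) (hg : ∀ᵐ x ∂μ, HasSum (fun n => f n x) (g x))
    (hψ : Continuous ψ) (hc : HasCompactSupport ψ) :
    ∫ x, g x * ψ x ∂μ = ∑' n, ∫ x, f n x * ψ x ∂μ := by
  obtain ⟨C, hC, hψC⟩ := exists_eLpNorm_mul_le (μ := μ) hp hψ hc
  have hL1 : ∑' n, ∫⁻ x, ‖f n x * ψ x‖ₑ ∂μ ≠ ⊤ := by
    refine ne_top_of_le_ne_top (ENNReal.mul_ne_top hC hsum) ?_
    rw [← ENNReal.tsum_mul_left]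
    refine ENNReal.tsum_le_tsum fun n => ?_
    simpa only [eLpNorm_one_eq_lintegral_enorm, Pi.mul_apply, mul_comm (ψ _)] using hψC _ (hf n)
  have hmeas (n : ι) : AEStronglyMeasurable (fun x => f n x * ψ x) μ :=
    (hf n).mul hψ.aestronglyMeasurable
  rw [← integral_tsum hmeas hL1]
  exact integral_congr_ae (hg.mono fun x hx => (hx.mul_right (ψ x)).tsum_eq.symm)

end Lp

variable {N : ℕ} {Ω : Set (EuclideanSpace ℝ (Fin N))} {i : Fin N} {p q : ℝ}
  {u v w g h φ ψ η : EuclideanSpace ℝ (Fin N) → ℝ} {A : Set (EuclideanSpace ℝ (Fin N))}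

section WeakDerivative

/-- The classical partial derivative `∂φ/∂xᵢ`, applied to test functions and cutoffs. -/
noncomputable def partialDeriv (i : Fin N) (φ : EuclideanSpace ℝ (Fin N) → ℝ) :
    EuclideanSpace ℝ (Fin N) → ℝ :=
  fun x => fderiv ℝ φ x (EuclideanSpace.single i 1)

lemma continuous_partialDeriv (hφ : ContDiff ℝ ∞ φ) (i : Fin N) :
    Continuous (partialDeriv i φ) :=
  (hφ.continuous_fderiv (by simp)).clm_apply continuous_const

lemma hasCompactSupport_partialDeriv (hφ : HasCompactSupport φ) (i : Fin N) :
    HasCompactSupport (partialDeriv i φ) :=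
  hφ.fderiv_apply ℝ _

lemma tsupport_partialDeriv_subset (i : Fin N) (φ : EuclideanSpace ℝ (Fin N) → ℝ) :
    tsupport (partialDeriv i φ) ⊆ tsupport φ :=
  tsupport_fderiv_apply_subset ℝ _

lemma partialDeriv_mul (hη : Differentiable ℝ η) (hφ : Differentiable ℝ φ) (i : Fin N) :
    partialDeriv i (η * φ) = η * partialDeriv i φ + partialDeriv i η * φ := by
  ext x
  simp only [partialDeriv, fderiv_mul (hη x) (hφ x), add_apply, smul_apply,
    smul_eq_mul, Pi.add_apply, Pi.mul_apply, mul_comm (φ x)]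

lemma integrableOn_mul_of_tsupport_subset (hu : LocallyIntegrableOn u Ω) (hψ : Continuous ψ)
    (hc : HasCompactSupport ψ) (hs : tsupport ψ ⊆ Ω) : IntegrableOn (fun x => u x * ψ x) Ω := by
  have hK : IntegrableOn (fun x => u x * ψ x) (tsupport ψ) :=
    (hu.integrableOn_compact_subset hs hc).mul_continuousOn hψ.continuousOn hc
  refine ((integrableOn_iff_integrable_of_support_subset fun x hx => ?_).1 hK).integrableOn
  exact subset_tsupport ψ (right_ne_zero_of_mul hx)

lemma hasWeakPartial_zero (i : Fin N) : HasWeakPartial Ω i 0 0 :=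
  ⟨locallyIntegrableOn_zero, locallyIntegrableOn_zero, fun φ _ _ _ => by simp⟩

namespace HasWeakPartial

lemma integral_mul_partialDeriv (hu : HasWeakPartial Ω i u g) (hφ : ContDiff ℝ ∞ φ)
    (hc : HasCompactSupport φ) (hs : tsupport φ ⊆ Ω) :
    ∫ x in Ω, u x * partialDeriv i φ x = -∫ x in Ω, g x * φ x :=
  hu.2.2 φ hφ hc hs

lemma integrableOn_mul (hu : HasWeakPartial Ω i u g) (hφ : Continuous φ)
    (hc : HasCompactSupport φ) (hs : tsupport φ ⊆ Ω) : IntegrableOn (fun x => g x * φ x) Ω :=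
  integrableOn_mul_of_tsupport_subset hu.2.1 hφ hc hs

lemma integrableOn_mul_partialDeriv (hu : HasWeakPartial Ω i u g) (hφ : ContDiff ℝ ∞ φ)
    (hc : HasCompactSupport φ) (hs : tsupport φ ⊆ Ω) :
    IntegrableOn (fun x => u x * partialDeriv i φ x) Ω :=
  integrableOn_mul_of_tsupport_subset hu.1 (continuous_partialDeriv hφ i)
    (hasCompactSupport_partialDeriv hc i) ((tsupport_partialDeriv_subset i φ).trans hs)

lemma sub (hu : HasWeakPartial Ω i u g) (hv : HasWeakPartial Ω i v h) :
    HasWeakPartial Ω i (u - v) (g - h) := by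
  refine ⟨hu.1.sub hv.1, hu.2.1.sub hv.2.1, fun φ hφ hc hs => ?_⟩
  change ∫ x in Ω, (u - v) x * partialDeriv i φ x = _
  simp only [Pi.sub_apply, sub_mul]
  rw [integral_sub (hu.integrableOn_mul_partialDeriv hφ hc hs)
      (hv.integrableOn_mul_partialDeriv hφ hc hs),
    integral_sub (hu.integrableOn_mul hφ.continuous hc hs)
      (hv.integrableOn_mul hφ.continuous hc hs),
    hu.integral_mul_partialDeriv hφ hc hs, hv.integral_mul_partialDeriv hφ hc hs]
  ring

lemma add (hu : HasWeakPartial Ω i u g) (hv : HasWeakPartial Ω i v h) :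
    HasWeakPartial Ω i (u + v) (g + h) := by
  simpa using hu.sub ((hasWeakPartial_zero i).sub hv)

lemma contDiff_mul (hΩ : IsOpen Ω) (hu : HasWeakPartial Ω i u g) (hη : ContDiff ℝ ∞ η) :
    HasWeakPartial Ω i (η * u) (η * g + partialDeriv i η * u) := by
  have hη' := continuous_partialDeriv hη i
  refine ⟨hu.1.continuousOn_mul hη.continuous.continuousOn hΩ.isLocallyClosed,
    (hu.2.1.continuousOn_mul hη.continuous.continuousOn hΩ.isLocallyClosed).add
      (hu.1.continuousOn_mul hη'.continuousOn hΩ.isLocallyClosed), fun φ hφ hc hs => ?_⟩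
  have hsηφ : tsupport (η * φ) ⊆ Ω := tsupport_mul_subset_right.trans hs
  have hint : IntegrableOn (fun x => u x * partialDeriv i (η * φ) x) Ω :=
    hu.integrableOn_mul_partialDeriv (hη.mul hφ) hc.mul_left hsηφ
  have hint' : IntegrableOn (fun x => u x * (partialDeriv i η * φ) x) Ω :=
    integrableOn_mul_of_tsupport_subset hu.1 (hη'.mul hφ.continuous) hc.mul_left
      (tsupport_mul_subset_right.trans hs)
  have hleibniz := partialDeriv_mul (hη.differentiable (by simp)) (hφ.differentiable (by simp)) i
  calc ∫ x in Ω, (η * u) x * partialDeriv i φ x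
    _ = ∫ x in Ω, (u x * partialDeriv i (η * φ) x - u x * (partialDeriv i η * φ) x) := by
      congr with x
      simp only [hleibniz, Pi.add_apply, Pi.mul_apply]
      ring
    _ = -((∫ x in Ω, g x * (η * φ) x) + ∫ x in Ω, u x * (partialDeriv i η * φ) x) := by
      rw [integral_sub hint hint',
        hu.integral_mul_partialDeriv (φ := η * φ) (hη.mul hφ) hc.mul_left hsηφ]
      ring
    _ = -∫ x in Ω, (η * g + partialDeriv i η * u) x * φ x := by
      rw [← integral_add (hu.integrableOn_mul (hη.continuous.mul hφ.continuous) hc.mul_left hsηφ)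
        hint']
      congr with x
      simp only [Pi.add_apply, Pi.mul_apply]
      ring

lemma ae_eq (hΩ : IsOpen Ω) (hg : HasWeakPartial Ω i u g) (hh : HasWeakPartial Ω i u h) :
    g =ᵐ[volume.restrict Ω] h := by
  have hzero : HasWeakPartial Ω i 0 (g - h) := by simpa using hg.sub hh
  have hae : ∀ᵐ x, x ∈ Ω → (g - h) x = 0 :=
    hΩ.ae_eq_zero_of_integral_contDiff_smul_eq_zero hzero.2.1 fun φ hφ hc hs => by
      have hφ0 : ∀ x ∉ Ω, φ x • (g - h) x = 0 := fun x hx => by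
        rw [image_eq_zero_of_notMem_tsupport fun hxs => hx (hs hxs), zero_smul]
      rw [← setIntegral_eq_integral_of_forall_compl_eq_zero hφ0]
      simpa [mul_comm] using hzero.integral_mul_partialDeriv hφ hc hs
  rw [EventuallyEq, ae_restrict_iff' hΩ.measurableSet]
  filter_upwards [hae] with x hx hxΩ using sub_eq_zero.1 (hx hxΩ)

lemma weakPartial_of_exists (hu : ∃ g, HasWeakPartial Ω i u g) :
    HasWeakPartial Ω i u (weakPartial Ω i u) := by
  rw [weakPartial, dif_pos hu]
  exact hu.choose_spec

lemma weakPartial_ae_eq (hΩ : IsOpen Ω) (hg : HasWeakPartial Ω i u g) :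
    weakPartial Ω i u =ᵐ[volume.restrict Ω] g :=
  (weakPartial_of_exists ⟨g, hg⟩).ae_eq hΩ hg

lemma of_hasSum {ι : Type*} [Countable ι] {p : ℝ≥0∞} (hp : 1 ≤ p)
    {us gs : ι → EuclideanSpace ℝ (Fin N) → ℝ} (hus : ∀ n, HasWeakPartial Ω i (us n) (gs n))
    (husum : ∑' n, eLpNorm (us n) p (volume.restrict Ω) ≠ ⊤)
    (hgsum : ∑' n, eLpNorm (gs n) p (volume.restrict Ω) ≠ ⊤)
    (hu : ∀ᵐ x ∂volume.restrict Ω, HasSum (fun n => us n x) (u x))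
    (hg : ∀ᵐ x ∂volume.restrict Ω, HasSum (fun n => gs n x) (g x)) :
    HasWeakPartial Ω i u g := by
  have hus_meas (n : ι) := (hus n).1.aestronglyMeasurable
  have hgs_meas (n : ι) := (hus n).2.1.aestronglyMeasurable
  refine ⟨locallyIntegrableOn_of_locallyIntegrable_restrict
      ((memLp_of_hasSum hp hus_meas husum hu).locallyIntegrable hp),
    locallyIntegrableOn_of_locallyIntegrable_restrict
      ((memLp_of_hasSum hp hgs_meas hgsum hg).locallyIntegrable hp), fun φ hφ hc hs => ?_⟩
  calc ∫ x in Ω, u x * partialDeriv i φ x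
    _ = ∑' n, ∫ x in Ω, us n x * partialDeriv i φ x :=
      integral_mul_eq_tsum_of_hasSum hp hus_meas husum hu
        (continuous_partialDeriv hφ i) (hasCompactSupport_partialDeriv hc i)
    _ = -∑' n, ∫ x in Ω, gs n x * φ x := by
      simp only [(hus _).integral_mul_partialDeriv hφ hc hs, tsum_neg]
    _ = -∫ x in Ω, g x * φ x := by
      rw [integral_mul_eq_tsum_of_hasSum hp hgs_meas hgsum hg hφ.continuous hc]

end HasWeakPartial

end WeakDerivative

section SobolevNorm

/-- The sum of the `L^p(Ω)`-norms of `u` and of its weak partial derivatives. It is equivalent to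
the norm of `W^{1,p}(Ω)` and has the advantage that its countable triangle inequality is inherited
term by term from `L^p(Ω)`. -/
noncomputable def sobolevNorm (Ω : Set (EuclideanSpace ℝ (Fin N))) (p : ℝ)
    (u : EuclideanSpace ℝ (Fin N) → ℝ) : ℝ≥0∞ :=
  eLpNorm u (ENNReal.ofReal p) (volume.restrict Ω) +
    ∑ i : Fin N, eLpNorm (weakPartial Ω i u) (ENNReal.ofReal p) (volume.restrict Ω)

lemma eLpNorm_le_sobolevNorm :
    eLpNorm u (ENNReal.ofReal p) (volume.restrict Ω) ≤ sobolevNorm Ω p u :=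
  le_self_add

lemma eLpNorm_weakPartial_le_sobolevNorm (i : Fin N) :
    eLpNorm (weakPartial Ω i u) (ENNReal.ofReal p) (volume.restrict Ω) ≤ sobolevNorm Ω p u :=
  (Finset.single_le_sum (f := fun j => eLpNorm (weakPartial Ω j u) (ENNReal.ofReal p)
    (volume.restrict Ω)) (fun _ _ => zero_le) (Finset.mem_univ i)).trans le_add_self

lemma sobolevNorm_eq_of_hasWeakPartial (hΩ : IsOpen Ω)
    {G : Fin N → EuclideanSpace ℝ (Fin N) → ℝ} (hG : ∀ i, HasWeakPartial Ω i u (G i)) :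
    sobolevNorm Ω p u = eLpNorm u (ENNReal.ofReal p) (volume.restrict Ω) +
      ∑ i, eLpNorm (G i) (ENNReal.ofReal p) (volume.restrict Ω) := by
  simp only [sobolevNorm, eLpNorm_congr_ae ((hG _).weakPartial_ae_eq hΩ)]

lemma sobolevNorm_le_mul_sobolevNormPow_rpow (hp : 0 < p) :
    sobolevNorm Ω p u ≤ (N + 1) * sobolevNormPow Ω p u ^ p⁻¹ := by
  have hu : eLpNorm u (ENNReal.ofReal p) (volume.restrict Ω) ≤ sobolevNormPow Ω p u ^ p⁻¹ :=
    (ENNReal.le_rpow_inv_iff hp).2 le_self_add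
  have hpartial (i : Fin N) : eLpNorm (weakPartial Ω i u) (ENNReal.ofReal p) (volume.restrict Ω) ≤
      sobolevNormPow Ω p u ^ p⁻¹ :=
    (ENNReal.le_rpow_inv_iff hp).2 <|
      (Finset.single_le_sum (f := fun j => eLpNorm (weakPartial Ω j u) (ENNReal.ofReal p)
        (volume.restrict Ω) ^ p) (fun _ _ => zero_le) (Finset.mem_univ i)).trans le_add_self
  calc sobolevNorm Ω p u
    _ ≤ sobolevNormPow Ω p u ^ p⁻¹ + ∑ _i : Fin N, sobolevNormPow Ω p u ^ p⁻¹ :=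
      add_le_add hu (Finset.sum_le_sum fun i _ => hpartial i)
    _ = (N + 1) * sobolevNormPow Ω p u ^ p⁻¹ := by simp; ring

lemma sobolevNormPow_le_mul_sobolevNorm_rpow (hp : 0 ≤ p) :
    sobolevNormPow Ω p u ≤ (N + 1) * sobolevNorm Ω p u ^ p := by
  calc sobolevNormPow Ω p u
    _ ≤ sobolevNorm Ω p u ^ p + ∑ _i : Fin N, sobolevNorm Ω p u ^ p :=
      add_le_add (ENNReal.rpow_le_rpow eLpNorm_le_sobolevNorm hp) (Finset.sum_le_sum fun i _ =>
        ENNReal.rpow_le_rpow (eLpNorm_weakPartial_le_sobolevNorm i) hp)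
    _ = (N + 1) * sobolevNorm Ω p u ^ p := by simp; ring

lemma exists_pos_forall_sobolevNormPow_lt (Ω : Set (EuclideanSpace ℝ (Fin N))) (hp : 0 < p)
    {ε : ℝ≥0∞} (hε : 0 < ε) :
    ∃ δ : ℝ≥0∞, 0 < δ ∧ ∀ u, sobolevNorm Ω p u < δ → sobolevNormPow Ω p u < ε := by
  obtain ⟨δ, hδ, hlt⟩ := exists_pos_forall_lt_mul_rpow_lt (C := N + 1) (by finiteness) hp hε
  exact ⟨δ, hδ, fun u hu =>
    (sobolevNormPow_le_mul_sobolevNorm_rpow hp.le).trans_lt (hlt _ hu)⟩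

lemma exists_pos_forall_sobolevNorm_lt (Ω : Set (EuclideanSpace ℝ (Fin N))) (hp : 0 < p)
    {ε : ℝ≥0∞} (hε : 0 < ε) :
    ∃ δ : ℝ≥0∞, 0 < δ ∧ ∀ u, sobolevNormPow Ω p u < δ → sobolevNorm Ω p u < ε := by
  obtain ⟨δ, hδ, hlt⟩ :=
    exists_pos_forall_lt_mul_rpow_lt (C := N + 1) (by finiteness) (inv_pos.2 hp) hε
  exact ⟨δ, hδ, fun u hu => (sobolevNorm_le_mul_sobolevNormPow_rpow hp).trans_lt (hlt _ hu)⟩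

end SobolevNorm

namespace MemW

lemma hasWeakPartial (hu : MemW Ω p u) (i : Fin N) :
    HasWeakPartial Ω i u (weakPartial Ω i u) :=
  .weakPartial_of_exists ((hu.2 i).imp fun _ hg => hg.1)

lemma aestronglyMeasurable_weakPartial (hu : MemW Ω p u) (i : Fin N) :
    AEStronglyMeasurable (weakPartial Ω i u) (volume.restrict Ω) :=
  (hu.hasWeakPartial i).2.1.aestronglyMeasurable

lemma sobolevNorm_ne_top (hΩ : IsOpen Ω) (hu : MemW Ω p u) : sobolevNorm Ω p u ≠ ⊤ := by
  refine ENNReal.add_ne_top.2 ⟨hu.1.eLpNorm_ne_top, ENNReal.sum_ne_top.2 fun i _ => ?_⟩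
  obtain ⟨g, hg, hgp⟩ := hu.2 i
  rw [eLpNorm_congr_ae (hg.weakPartial_ae_eq hΩ)]
  exact hgp.eLpNorm_ne_top

lemma of_sobolevNorm_ne_top (hmeas : AEStronglyMeasurable u (volume.restrict Ω))
    (hu : ∀ i, ∃ g, HasWeakPartial Ω i u g) (hfin : sobolevNorm Ω p u ≠ ⊤) : MemW Ω p u := by
  refine ⟨⟨hmeas, eLpNorm_le_sobolevNorm.trans_lt hfin.lt_top⟩, fun i => ?_⟩
  have hi := HasWeakPartial.weakPartial_of_exists (hu i)
  exact ⟨_, hi, hi.2.1.aestronglyMeasurable,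
    (eLpNorm_weakPartial_le_sobolevNorm i).trans_lt hfin.lt_top⟩

protected lemma zero : MemW Ω p 0 :=
  ⟨.zero, fun i => ⟨0, hasWeakPartial_zero i, .zero⟩⟩

lemma add (hu : MemW Ω p u) (hv : MemW Ω p v) : MemW Ω p (u + v) := by
  refine ⟨hu.1.add hv.1, fun i => ?_⟩
  obtain ⟨g, hg, hgp⟩ := hu.2 i
  obtain ⟨h, hh, hhp⟩ := hv.2 i
  exact ⟨g + h, hg.add hh, hgp.add hhp⟩

lemma sub (hu : MemW Ω p u) (hv : MemW Ω p v) : MemW Ω p (u - v) := by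
  refine ⟨hu.1.sub hv.1, fun i => ?_⟩
  obtain ⟨g, hg, hgp⟩ := hu.2 i
  obtain ⟨h, hh, hhp⟩ := hv.2 i
  exact ⟨g - h, hg.sub hh, hgp.sub hhp⟩

lemma sobolevNorm_add_le (hΩ : IsOpen Ω) (hp : 1 ≤ p) (hu : MemW Ω p u) (hv : MemW Ω p v) :
    sobolevNorm Ω p (u + v) ≤ sobolevNorm Ω p u + sobolevNorm Ω p v := by
  have hp' : 1 ≤ ENNReal.ofReal p := ENNReal.one_le_ofReal.2 hp
  rw [sobolevNorm_eq_of_hasWeakPartial hΩ fun i => (hu.hasWeakPartial i).add (hv.hasWeakPartial i),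
    sobolevNorm, sobolevNorm, add_add_add_comm, ← Finset.sum_add_distrib]
  exact add_le_add (eLpNorm_add_le hu.1.1 hv.1.1 hp') (Finset.sum_le_sum fun i _ =>
    eLpNorm_add_le (hu.aestronglyMeasurable_weakPartial i)
      (hv.aestronglyMeasurable_weakPartial i) hp')

lemma exists_contDiff_mul_and_sobolevNorm_le (hΩ : IsOpen Ω) (hq : 1 ≤ q) (hqp : q ≤ p)
    (hη : ContDiff ℝ ∞ η) (hc : HasCompactSupport η) :
    ∃ C ≠ ⊤, ∀ u, MemW Ω p u →
      MemW Ω q (η * u) ∧ sobolevNorm Ω q (η * u) ≤ C * sobolevNorm Ω p u := by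
  have hqp' := ENNReal.ofReal_le_ofReal hqp
  have hη' := continuous_partialDeriv hη
  obtain ⟨C₀, hC₀, hη_le⟩ :=
    exists_eLpNorm_mul_le (μ := volume.restrict Ω) hqp' hη.continuous hc
  choose C hC hη'_le using fun i => exists_eLpNorm_mul_le (μ := volume.restrict Ω) hqp' (hη' i)
    (hasCompactSupport_partialDeriv hc i)
  have hC_top : C₀ + ∑ i, (C₀ + C i) ≠ ⊤ := by simp [hC₀, hC]
  refine ⟨_, hC_top, fun u hu => ?_⟩
  have hG := fun i => (hu.hasWeakPartial i).contDiff_mul hΩ hη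
  have hu_le : eLpNorm (η * u) (ENNReal.ofReal q) (volume.restrict Ω) ≤
      C₀ * sobolevNorm Ω p u :=
    (hη_le u hu.1.1).trans (by gcongr; exact eLpNorm_le_sobolevNorm)
  have hG_le (i : Fin N) : eLpNorm (η * weakPartial Ω i u + partialDeriv i η * u)
      (ENNReal.ofReal q) (volume.restrict Ω) ≤ (C₀ + C i) * sobolevNorm Ω p u := by
    have hgi := hu.aestronglyMeasurable_weakPartial i
    rw [add_mul]
    refine (eLpNorm_add_le (hη.continuous.aestronglyMeasurable.mul hgi)
      ((hη' i).aestronglyMeasurable.mul hu.1.1) (ENNReal.one_le_ofReal.2 hq)).trans ?_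
    gcongr
    · exact (hη_le _ hgi).trans (by gcongr; exact eLpNorm_weakPartial_le_sobolevNorm i)
    · exact (hη'_le i _ hu.1.1).trans (by gcongr; exact eLpNorm_le_sobolevNorm)
  have hle : sobolevNorm Ω q (η * u) ≤ (C₀ + ∑ i, (C₀ + C i)) * sobolevNorm Ω p u := by
    rw [sobolevNorm_eq_of_hasWeakPartial hΩ hG, add_mul, Finset.sum_mul]
    exact add_le_add hu_le (Finset.sum_le_sum fun i _ => hG_le i)
  have hfin : sobolevNorm Ω q (η * u) ≠ ⊤ :=
    ne_top_of_le_ne_top (ENNReal.mul_ne_top hC_top (hu.sobolevNorm_ne_top hΩ)) hle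
  exact ⟨.of_sobolevNorm_ne_top (hη.continuous.aestronglyMeasurable.mul hu.1.1)
    (fun i => ⟨_, hG i⟩) hfin, hle⟩

end MemW

lemma memW_and_sobolevNorm_le_tsum_of_hasSum {ι : Type*} [Countable ι] (hΩ : IsOpen Ω) (hp : 1 ≤ p)
    {us : ι → EuclideanSpace ℝ (Fin N) → ℝ} (hus : ∀ n, MemW Ω p (us n))
    (hsum : ∑' n, sobolevNorm Ω p (us n) ≠ ⊤)
    (hu : ∀ᵐ x ∂volume.restrict Ω, HasSum (fun n => us n x) (u x)) :
    MemW Ω p u ∧ sobolevNorm Ω p u ≤ ∑' n, sobolevNorm Ω p (us n) := by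
  have hp' : 1 ≤ ENNReal.ofReal p := ENNReal.one_le_ofReal.2 hp
  have hus_meas (n : ι) := (hus n).1.1
  have hgs_meas (i : Fin N) (n : ι) := (hus n).aestronglyMeasurable_weakPartial i
  have husum : ∑' n, eLpNorm (us n) (ENNReal.ofReal p) (volume.restrict Ω) ≠ ⊤ :=
    ne_top_of_le_ne_top hsum (ENNReal.tsum_le_tsum fun n => eLpNorm_le_sobolevNorm)
  have hgsum (i : Fin N) :
      ∑' n, eLpNorm (weakPartial Ω i (us n)) (ENNReal.ofReal p) (volume.restrict Ω) ≠ ⊤ :=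
    ne_top_of_le_ne_top hsum
      (ENNReal.tsum_le_tsum fun n => eLpNorm_weakPartial_le_sobolevNorm i)
  have hg (i : Fin N) : ∀ᵐ x ∂volume.restrict Ω, HasSum (fun n => weakPartial Ω i (us n) x)
      (∑' n, weakPartial Ω i (us n) x) :=
    (summable_norm_of_tsum_eLpNorm_ne_top hp' (hgs_meas i) (hgsum i)).mono
      fun x hx => hx.of_norm.hasSum
  have hG (i : Fin N) : HasWeakPartial Ω i u (fun x => ∑' n, weakPartial Ω i (us n) x) :=
    .of_hasSum hp' (fun n => (hus n).hasWeakPartial i) husum (hgsum i) hu (hg i)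
  have hle : sobolevNorm Ω p u ≤ ∑' n, sobolevNorm Ω p (us n) := by
    rw [sobolevNorm_eq_of_hasWeakPartial hΩ hG]
    simp only [sobolevNorm, ENNReal.tsum_add, Summable.tsum_finsetSum fun _ _ => ENNReal.summable]
    exact add_le_add (eLpNorm_le_tsum_of_hasSum hp' hus_meas hu)
      (Finset.sum_le_sum fun i _ => eLpNorm_le_tsum_of_hasSum hp' (hgs_meas i) (hg i))
  exact ⟨.of_sobolevNorm_ne_top (memLp_of_hasSum hp' hus_meas husum hu).1 (fun i => ⟨_, hG i⟩)
    (ne_top_of_le_ne_top hsum hle), hle⟩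

namespace MemCc

protected lemma zero : MemCc Ω 0 :=
  ⟨continuous_zero, HasCompactSupport.zero⟩

lemma add (hv : MemCc Ω v) (hw : MemCc Ω w) : MemCc Ω (v + w) :=
  ⟨hv.1.add hw.1, hv.2.add hw.2⟩

lemma continuous_mul (hη : Continuous η) (hv : MemCc Ω v) : MemCc Ω (η * v) :=
  ⟨(hη.comp continuous_subtype_val).mul hv.1,
    hv.2.mul_left (f := (closure Ω).domRestrict η)⟩

end MemCc

lemma memWTilde_iff (hp : 0 < p) :
    MemWTilde Ω p u ↔ MemW Ω p u ∧ ∀ ε : ℝ≥0∞, 0 < ε →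
      ∃ v, MemW Ω p v ∧ MemCc Ω v ∧ sobolevNorm Ω p (u - v) < ε := by
  refine and_congr_right fun _ => ⟨fun h ε hε => ?_, fun h ε hε => ?_⟩
  · obtain ⟨δ, hδ, hlt⟩ := exists_pos_forall_sobolevNorm_lt Ω hp hε
    obtain ⟨v, hv, hvc, huv⟩ := h δ hδ
    exact ⟨v, hv, hvc, hlt _ huv⟩
  · obtain ⟨δ, hδ, hlt⟩ := exists_pos_forall_sobolevNormPow_lt Ω hp hε
    obtain ⟨v, hv, hvc, huv⟩ := h δ hδ
    exact ⟨v, hv, hvc, hlt _ huv⟩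

namespace MemWTilde

lemma exists_sobolevNorm_sub_lt (hp : 0 < p) (hu : MemWTilde Ω p u) {ε : ℝ≥0∞} (hε : 0 < ε) :
    ∃ v, MemW Ω p v ∧ MemCc Ω v ∧ sobolevNorm Ω p (u - v) < ε :=
  ((memWTilde_iff hp).1 hu).2 ε hε

lemma of_forall_exists_sobolevNorm_sub_lt (hΩ : IsOpen Ω) (hp : 1 ≤ p) (hu : MemW Ω p u)
    (happrox : ∀ ε : ℝ≥0∞, 0 < ε → ∃ w, MemWTilde Ω p w ∧ sobolevNorm Ω p (u - w) < ε) :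
    MemWTilde Ω p u := by
  have hp0 : 0 < p := one_pos.trans_le hp
  refine (memWTilde_iff hp0).2 ⟨hu, fun ε hε => ?_⟩
  obtain ⟨w, hw, huw⟩ := happrox (ε / 2) (ENNReal.half_pos hε.ne')
  obtain ⟨v, hv, hvc, hwv⟩ := hw.exists_sobolevNorm_sub_lt hp0 (ENNReal.half_pos hε.ne')
  refine ⟨v, hv, hvc, ?_⟩
  calc sobolevNorm Ω p (u - v)
    _ = sobolevNorm Ω p ((u - w) + (w - v)) := by rw [sub_add_sub_cancel]
    _ ≤ sobolevNorm Ω p (u - w) + sobolevNorm Ω p (w - v) :=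
      (hu.sub hw.1).sobolevNorm_add_le hΩ hp (hw.1.sub hv)
    _ < ε / 2 + ε / 2 := ENNReal.add_lt_add huw hwv
    _ = ε := ENNReal.add_halves ε

protected lemma zero (hΩ : IsOpen Ω) (hp : 0 < p) : MemWTilde Ω p 0 := by
  refine (memWTilde_iff hp).2 ⟨.zero, fun ε hε => ⟨0, .zero, .zero, ?_⟩⟩
  simpa [sobolevNorm_eq_of_hasWeakPartial hΩ hasWeakPartial_zero] using hε

lemma add (hΩ : IsOpen Ω) (hp : 1 ≤ p) (hu : MemWTilde Ω p u) (hv : MemWTilde Ω p v) :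
    MemWTilde Ω p (u + v) := by
  have hp0 : 0 < p := one_pos.trans_le hp
  refine (memWTilde_iff hp0).2 ⟨hu.1.add hv.1, fun ε hε => ?_⟩
  obtain ⟨u', hu', huc, hu_lt⟩ := hu.exists_sobolevNorm_sub_lt hp0 (ENNReal.half_pos hε.ne')
  obtain ⟨v', hv', hvc, hv_lt⟩ := hv.exists_sobolevNorm_sub_lt hp0 (ENNReal.half_pos hε.ne')
  refine ⟨u' + v', hu'.add hv', huc.add hvc, ?_⟩
  calc sobolevNorm Ω p (u + v - (u' + v'))
    _ = sobolevNorm Ω p ((u - u') + (v - v')) := by rw [add_sub_add_comm]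
    _ ≤ sobolevNorm Ω p (u - u') + sobolevNorm Ω p (v - v') :=
      (hu.1.sub hu').sobolevNorm_add_le hΩ hp (hv.1.sub hv')
    _ < ε / 2 + ε / 2 := ENNReal.add_lt_add hu_lt hv_lt
    _ = ε := ENNReal.add_halves ε

lemma finsetSum {ι : Type*} (hΩ : IsOpen Ω) (hp : 1 ≤ p) {us : ι → EuclideanSpace ℝ (Fin N) → ℝ}
    (hus : ∀ n, MemWTilde Ω p (us n)) (s : Finset ι) : MemWTilde Ω p (∑ n ∈ s, us n) :=
  Finset.sum_induction us (MemWTilde Ω p) (fun _ _ hu hv => hu.add hΩ hp hv)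
    (.zero hΩ (one_pos.trans_le hp)) fun n _ => hus n

lemma of_hasSum {ι : Type*} [Countable ι] (hΩ : IsOpen Ω) (hp : 1 ≤ p)
    {us : ι → EuclideanSpace ℝ (Fin N) → ℝ} (hus : ∀ n, MemWTilde Ω p (us n))
    (hsum : ∑' n, sobolevNorm Ω p (us n) ≠ ⊤)
    (hu : ∀ᵐ x ∂volume.restrict Ω, HasSum (fun n => us n x) (u x)) : MemWTilde Ω p u := by
  have huW := (memW_and_sobolevNorm_le_tsum_of_hasSum hΩ hp (fun n => (hus n).1) hsum hu).1
  refine of_forall_exists_sobolevNorm_sub_lt hΩ hp huW fun ε hε => ?_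
  obtain ⟨s, hs⟩ :=
    ((ENNReal.tendsto_tsum_compl_atTop_zero hsum).eventually_lt_const hε).exists
  have htail : ∀ᵐ x ∂volume.restrict Ω,
      HasSum (fun n : {n // n ∉ s} => us n x) ((u - ∑ n ∈ s, us n) x) :=
    hu.mono fun x hx => (Finset.hasSum_compl_iff (f := fun n => us n x) s).2 (by simpa using hx)
  have htail_sum := memW_and_sobolevNorm_le_tsum_of_hasSum hΩ hp (fun n : {n // n ∉ s} => (hus n).1)
    hs.ne_top htail
  exact ⟨_, finsetSum hΩ hp hus s, htail_sum.2.trans_lt hs⟩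

lemma contDiff_mul (hΩ : IsOpen Ω) (hq : 1 ≤ q) (hqp : q ≤ p) (hη : ContDiff ℝ ∞ η)
    (hc : HasCompactSupport η) (hu : MemWTilde Ω p u) : MemWTilde Ω q (η * u) := by
  have hq0 : 0 < q := one_pos.trans_le hq
  obtain ⟨C, hC, hmul⟩ := MemW.exists_contDiff_mul_and_sobolevNorm_le hΩ hq hqp hη hc
  refine (memWTilde_iff hq0).2 ⟨(hmul u hu.1).1, fun ε hε => ?_⟩
  obtain ⟨v, hv, hvc, huv⟩ :=
    hu.exists_sobolevNorm_sub_lt (hq0.trans_le hqp) (ENNReal.div_pos hε.ne' hC)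
  refine ⟨η * v, (hmul v hv).1, hvc.continuous_mul hη.continuous, ?_⟩
  rw [← mul_sub]
  exact (hmul _ (hu.1.sub hv)).2.trans_lt (ENNReal.mul_lt_of_lt_div' huv)

end MemWTilde

lemma relCap_eq_zero_iff (hp : 0 < p) :
    relCap Ω p A = 0 ↔ ∀ ε : ℝ≥0∞, 0 < ε → ∃ u ∈ admissible Ω p A, sobolevNorm Ω p u < ε := by
  simp only [relCap, ← bot_eq_zero, iInf₂_eq_bot, exists_prop]
  refine ⟨fun h ε hε => ?_, fun h ε hε => ?_⟩
  · obtain ⟨δ, hδ, hlt⟩ := exists_pos_forall_sobolevNorm_lt Ω hp hε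
    exact (h δ hδ).imp fun u hu => hu.imp_right (hlt u)
  · obtain ⟨δ, hδ, hlt⟩ := exists_pos_forall_sobolevNormPow_lt Ω hp hε
    exact (h δ hδ).imp fun u hu => hu.imp_right (hlt u)

lemma IsRelOpen.measurableSet {O : Set (EuclideanSpace ℝ (Fin N))} (hO : IsRelOpen Ω O) :
    MeasurableSet O := by
  obtain ⟨U, hU, rfl⟩ := hO
  exact hU.measurableSet.inter isClosed_closure.measurableSet

lemma exists_isRelOpen_ae_one_le_finsum {ι : Type*} [Countable ι] [Nonempty ι]
    (ρ : SmoothPartitionOfUnity ι 𝓘(ℝ, EuclideanSpace ℝ (Fin N)) (EuclideanSpace ℝ (Fin N)))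
    {us : ι → EuclideanSpace ℝ (Fin N) → ℝ}
    (hus : ∀ n, ∃ O, IsRelOpen Ω O ∧ A ⊆ O ∧ ∀ᵐ x ∂volume.restrict (O ∩ Ω), 1 ≤ us n x) :
    ∃ O, IsRelOpen Ω O ∧ A ⊆ O ∧
      ∀ᵐ x ∂volume.restrict (O ∩ Ω), 1 ≤ ∑ᶠ n, ρ n x * us n x := by
  choose O hO hAO hus_ge using hus
  choose U hU hOU using hO
  have hAU (n : ι) : A ⊆ U n := (hAO n).trans ((hOU n).subset.trans inter_subset_left)
  have hA : A ⊆ closure Ω := by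
    let n : ι := Classical.arbitrary ι
    exact (hAO n).trans ((hOU n).subset.trans inter_subset_right)
  let V := {x | ∀ n, x ∈ tsupport (ρ n) → x ∈ U n}
  have hV : IsOpen V := isOpen_setOf_forall_mem_imp_mem ρ.locallyFinite.closure
    (fun n => isClosed_tsupport _) hU
  have hVO : IsRelOpen Ω (V ∩ closure Ω) := ⟨V, hV, rfl⟩
  refine ⟨V ∩ closure Ω, hVO, fun x hx => ⟨fun n _ => hAU n hx, hA hx⟩, ?_⟩
  have hus_imp (n : ι) : ∀ᵐ x ∂volume.restrict Ω, x ∈ O n → 1 ≤ us n x := by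
    have hOn : MeasurableSet (O n) := IsRelOpen.measurableSet ⟨U n, hU n, hOU n⟩
    rw [← ae_restrict_iff' hOn, Measure.restrict_restrict hOn]
    exact hus_ge n
  rw [← Measure.restrict_restrict hVO.measurableSet, ae_restrict_iff' hVO.measurableSet]
  filter_upwards [ae_all_iff.2 hus_imp] with x hx ⟨hxV, hxΩ⟩
  refine ρ.finsum_smul_mem_convex (mem_univ x) (fun n hn => hx n ?_) (convex_Ici (1 : ℝ))
  exact (hOU n).superset ⟨hxV n (subset_tsupport _ hn), hxΩ⟩

lemma exists_mem_admissible_sobolevNorm_lt (hΩ : IsOpen Ω) (hq : 1 ≤ q) (hqp : q ≤ p)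
    (hp_small : ∀ δ : ℝ≥0∞, 0 < δ → ∃ u ∈ admissible Ω p A, sobolevNorm Ω p u < δ)
    {ε : ℝ≥0∞} (hε : 0 < ε) : ∃ u ∈ admissible Ω q A, sobolevNorm Ω q u < ε := by
  obtain ⟨ρ, hρc⟩ := exists_smoothPartitionOfUnity_hasCompactSupport (EuclideanSpace ℝ (Fin N))
  have hρ (n : ℕ) : ContDiff ℝ ∞ (ρ n) := (ρ n).contMDiff.contDiff
  choose C hC hmul using fun n =>
    MemW.exists_contDiff_mul_and_sobolevNorm_le hΩ hq hqp (hρ n) (hρc n)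
  obtain ⟨δ, hδ, hδε⟩ := ENNReal.exists_pos_sum_of_countable' hε.ne' ℕ
  choose us hus hus_lt using fun n => hp_small (δ n / C n) (ENNReal.div_pos (hδ n).ne' (hC n))
  have hle (n : ℕ) : sobolevNorm Ω q (ρ n * us n) ≤ δ n :=
    (hmul n _ (hus n).1.1).2.trans (ENNReal.mul_le_of_le_div' (hus_lt n).le)
  have hsum : ∑' n, sobolevNorm Ω q (ρ n * us n) < ε :=
    (ENNReal.tsum_le_tsum hle).trans_lt hδε
  have htilde (n : ℕ) : MemWTilde Ω q (ρ n * us n) :=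
    (hus n).1.contDiff_mul hΩ hq hqp (hρ n) (hρc n)
  have hhasSum (x : EuclideanSpace ℝ (Fin N)) :
      HasSum (fun n => (ρ n * us n) x) (∑ᶠ n, ρ n x * us n x) := by
    have hfin : (Function.support fun n => ρ n x * us n x).Finite :=
      (ρ.locallyFinite.point_finite x).subset fun n hn => left_ne_zero_of_mul hn
    rw [← tsum_eq_finsum (L := .unconditional ℕ) hfin]
    exact (summable_of_hasFiniteSupport hfin).hasSum
  obtain ⟨-, hnorm⟩ := memW_and_sobolevNorm_le_tsum_of_hasSum hΩ hq (fun n => (htilde n).1)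
    hsum.ne_top (.of_forall hhasSum)
  exact ⟨_, ⟨.of_hasSum hΩ hq htilde hsum.ne_top (.of_forall hhasSum),
    exists_isRelOpen_ae_one_le_finsum ρ fun n => (hus n).2⟩, hnorm.trans_lt hsum⟩

end RelativeCapacity

theorem mainTheorem12_general {N : ℕ} (Ω : Set (EuclideanSpace ℝ (Fin N))) (hΩ : IsOpen Ω)
    (p q : ℝ) (hq : 1 ≤ q) (hqp : q ≤ p) (A : Set (EuclideanSpace ℝ (Fin N)))
    (h : RelativeCapacity.relCap Ω p A = 0) : RelativeCapacity.relCap Ω q A = 0 := by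
  have hq0 : 0 < q := one_pos.trans_le hq
  rw [RelativeCapacity.relCap_eq_zero_iff (hq0.trans_le hqp)] at h
  rw [RelativeCapacity.relCap_eq_zero_iff hq0]
  exact fun ε hε => RelativeCapacity.exists_mem_admissible_sobolevNorm_lt hΩ hq hqp h hε

theorem mainTheorem12 {N : ℕ} (Ω : Set (EuclideanSpace ℝ (Fin N))) (hΩ : IsOpen Ω)
    (hne : Ω.Nonempty) (p q : ℝ) (hq : 1 < q) (hqp : q ≤ p)
    (A : Set (EuclideanSpace ℝ (Fin N))) (hA : A ⊆ closure Ω)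
    (h : RelativeCapacity.relCap Ω p A = 0) : RelativeCapacity.relCap Ω q A = 0 :=
  mainTheorem12_general Ω hΩ p q hq.le hqp A h
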